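/- Conventions. A compact closed category is a symmetric monoidal category $(\mathcal C,\otimes,I)$ with a contravariant (strong) monoidal functor $(\_)^*$ such that $((\_)^*)^*=\mathrm{Id}$, and arrows $\eta_A:I\to A\otimes A^*$, $\epsilon_A:A^*\otimes A\to I$ for every object $A$, satisfying the yanking (triangle) identities; write $[A\to B]=A^*\otimes B$ and $t_{A,B,C}:A\otimes(B\otimes C)\to(A\otimes B)\otimes C$ for the associator. It has trivial scalars if $\mathcal C(I,I)=\{1_I\}$. An object $N$ is strictly reflexive if $N=[N\to N]=N^*\otimes N$ and $N=N\otimes N$, i.e. the isomorphisms exhibiting reflexivity and self-similarity are identities (this holds in particular if $N^*=N$ and $N=N^*\otimes N$). $N$ is non-unit if $N\not\cong I$. A semi-monoidal monoid is a one-object semi-monoidal category (all of MacLane's axioms for a monoidal category except those on the unit object), that is, a monoid $M$ with a monoid homomorphism $\otimes:M\times M\to M$ and an invertible $\alpha\in M$ with $\alpha(f\otimes(g\otimes h))=((f\otimes g)\otimes h)\alpha$ and $(\alpha\otimes 1)\alpha(1\otimes\alpha)=\alpha^2$. An Abramsky--Heunen (A-H) Frobenius algebra in it is a pair $\Delta,\nabla\in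 M$ with $(1\otimes\nabla)\alpha^{-1}(\Delta\otimes1)=\Delta\nabla=(\nabla\otimes1)\alpha(1\otimes\Delta)$, $\nabla(1\otimes\nabla)=\nabla(\nabla\otimes1)\alpha$ and $\alpha(1\otimes\Delta)\Delta=(\Delta\otimes1)\Delta$; its A-H Frobenius monoid is the smallest submonoid of $M$ that is closed under $\otimes$ and contains $\alpha,\alpha^{-1},\Delta,\nabla$. Theorem. Let $N$ be a non-unit strictly reflexive object of a compact closed category $\mathcal C$ with trivial scalars. Let $X$ be an object and $\varphi:X^*\otimes X\to N$ an isomorphism (for example $X=N$ and $\varphi=1_N$). Let $\alpha=t_{N,N,N}\in\mathcal C(N,N)$, and let $\Delta:N\to N\otimes N=N$ and $\nabla:N=N\otimes N\to N$ be the transports along $\varphi$ of the arrows $1_{X^*}\otimes\eta_X\otimes1_X:X^*\otimes X\to (X^*\otimes X)\otimes(X^*\otimes X)$ and $1_{X^*}\otimes\epsilon_{X^*}\otimes1_X:(X^*\otimes X)\otimes(X^*\otimes X)\to X^*\otimes X$ (where $\epsilon_{X^*}:X\otimes X^*\to I$, as $X^{**}=X$). Then $(\mathcal C(N,N),\otimes,\alpha)$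 is a semi-monoidal monoid, and $(\Delta,\nabla)$ is an A-H Frobenius algebra in it. Let $\mathbb A\subseteq\mathcal C(N,N)$ be its A-H Frobenius monoid (the simple A-H F monoid). Then: 1. $\mathbb A$ is the closure of $\{\alpha,\alpha^{-1},\Delta,\nabla\}$ under composition and tensor. 2. The closure of $\{\alpha,\alpha^{-1}\}$ under composition and tensor is contained in $\mathbb A$ and is isomorphic to Thompson's group $\mathcal F=\langle x_0,x_1,x_2,\ldots : x_i^{-1}x_jx_i=x_{j+1}\ \forall\, i<j\rangle$. 3. $\nabla\Delta=1\neq\Delta\nabla$, and the submonoid generated by $\Delta$ and $\nabla$ under composition is contained in $\mathbb A$ and is isomorphic to the bicyclic monoid $\langle s,r : rs=1\rangle$, via $s\mapsto\Delta$, $r\mapsto\nabla$. -/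

import Mathlib

open CategoryTheory MonoidalCategory Opposite

universe v u

/-- A compact closed structure on a symmetric monoidal category: a contravariant (strong) monoidal
functor `A ↦ A*` with `(A*)* = A`, and for every object `A` a unit `η_A : I ⟶ A ⊗ A*` and a co-unit
`ε_A : A* ⊗ A ⟶ I` satisfying the yanking axiom. -/
class CompactClosedCategory (C : Type u) [Category.{v} C] [MonoidalCategory C]
    [SymmetricCategory C] where
  /-- the dual `(_)*` -/
  dual : Cᵒᵖ ⥤ C
  dualMonoidal : dual.Monoidal
  dual_dual : dual.rightOp ⋙ dual = 𝟭 C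
  /-- `η_A : I ⟶ A ⊗ A*` -/
  unit (A : C) : 𝟙_ C ⟶ A ⊗ dual.obj (op A)
  /-- `ε_A : A* ⊗ A ⟶ I` -/
  counit (A : C) : dual.obj (op A) ⊗ A ⟶ 𝟙_ C
  /-- `(1_A ⊗ ε_A)(η_A ⊗ 1_A) = 1_A`, with the coherence isomorphisms written out -/
  yanking (A : C) :
    unit A ▷ A ≫ (α_ A (dual.obj (op A)) A).hom ≫ A ◁ counit A = (λ_ A).hom ≫ (ρ_ A).inv
  /-- `(ε_A ⊗ 1_{A*})(1_{A*} ⊗ η_A) = 1_{A*}`, with the coherence isomorphisms written out.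
  Since every object is of the form `A*` and `A** = A`, asking this for all `A` is the same as asking
  `(ε_{A*} ⊗ 1_A)(1_A ⊗ η_{A*}) = 1_A` for all `A`. -/
  yanking_dual (A : C) :
    dual.obj (op A) ◁ unit A ≫ (α_ (dual.obj (op A)) A (dual.obj (op A))).inv ≫
      counit A ▷ dual.obj (op A) = (ρ_ (dual.obj (op A))).hom ≫ (λ_ (dual.obj (op A))).inv

namespace CompactClosedCategory

section Dual

variable {C : Type u} [Category.{v} C] [MonoidalCategory C] [SymmetricCategory C]
  [CompactClosedCategory C]

/-- The dual object `A*`. -/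
def dualObj (A : C) : C := dual.obj (op A)

theorem dualObj_dualObj (A : C) : dualObj (dualObj A) = A :=
  congrArg (fun F : C ⥤ C => F.obj A) (dual_dual (C := C))

/-- The internal hom `[A → B] = A* ⊗ B`. -/
def internalHom (A B : C) : C := dualObj A ⊗ B

/-- `η_X : I ⟶ X ⊗ X*`. -/
def cup (X : C) : 𝟙_ C ⟶ X ⊗ dualObj X := unit X

/-- `ε_{X*} : X ⊗ X* = X** ⊗ X* ⟶ I`. -/
def cap (X : C) : X ⊗ dualObj X ⟶ 𝟙_ C :=
  eqToHom (dualObj_dualObj X).symm ▷ dualObj X ≫ counit (dualObj X)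

/-- `Δ = 1_{X*} ⊗ η_X ⊗ 1_X : X* ⊗ X ⟶ (X* ⊗ X) ⊗ (X* ⊗ X)`, the split arrow of the canonical
Frobenius algebra at `X* ⊗ X`. -/
def canonicalSplit (X : C) :
    dualObj X ⊗ X ⟶ (dualObj X ⊗ X) ⊗ (dualObj X ⊗ X) :=
  dualObj X ◁ (λ_ X).inv ≫ dualObj X ◁ (cup X ▷ X) ≫
    dualObj X ◁ (α_ X (dualObj X) X).hom ≫ (α_ (dualObj X) X (dualObj X ⊗ X)).inv

/-- `∇ = 1_{X*} ⊗ ε_{X*} ⊗ 1_X : (X* ⊗ X) ⊗ (X* ⊗ X) ⟶ X* ⊗ X`, the merge arrow of the canonical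
Frobenius algebra at `X* ⊗ X`. -/
def canonicalMerge (X : C) :
    (dualObj X ⊗ X) ⊗ (dualObj X ⊗ X) ⟶ dualObj X ⊗ X :=
  (α_ (dualObj X) X (dualObj X ⊗ X)).hom ≫ dualObj X ◁ (α_ X (dualObj X) X).inv ≫
    dualObj X ◁ (cap X ▷ X) ≫ dualObj X ◁ (λ_ X).hom

/-- Strict reflexivity in a compact closed category: the isomorphisms exhibiting
`N ≅ [N → N] = N* ⊗ N` and `N ≅ N ⊗ N` are identity arrows. -/
structure IsStrictlyReflexive (N : C) : Prop where
  internalHom_eq : internalHom N N = N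
  tensor_eq : N ⊗ N = N

end Dual

end CompactClosedCategory

/-! ### One-object semi-monoidal categories -/

section SemiMonoidal

variable {M : Type*} [Monoid M]

/-- `(M, t, a)`, with `a'` the inverse of `a`, is a semi-monoidal monoid, i.e. a semi-monoidal
category with exactly one object, whose monoid of arrows is `M`, whose tensor is `t` on arrows, and
whose associator is `a`. -/
structure IsSemiMonoidalMonoid (t : M → M → M) (a a' : M) : Prop where
  tensor_one : t 1 1 = 1
  tensor_mul (f g f' g' : M) : t (f * f') (g * g') = t f g * t f' g'
  mul_inv : a * a' = 1
  inv_mul : a' * a = 1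
  naturality (f g h : M) : a * t f (t g h) = t (t f g) h * a
  pentagon : t a 1 * a * t 1 a = a * a

/-- `(Δ, ∇) = (d, m)` is an Abramsky-Heunen (unitless) Frobenius algebra at the unique object of the
semi-monoidal monoid `(M, t, a)`, where `a' = a⁻¹`. -/
structure IsAHFrobenius (t : M → M → M) (a a' d m : M) : Prop where
  frobenius_left : t 1 m * a' * t d 1 = d * m
  frobenius_right : t m 1 * a * t 1 d = d * m
  assoc : m * t 1 m = m * t m 1 * a
  coassoc : a * t 1 d * d = t d 1 * d

/-- The elements of `M` obtained from those of `S` by (binary) composition and tensor. -/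
inductive CompTensorClosure (t : M → M → M) (S : Set M) : M → Prop
  | of (f : M) : f ∈ S → CompTensorClosure t S f
  | comp (f g : M) : CompTensorClosure t S f → CompTensorClosure t S g →
      CompTensorClosure t S (f * g)
  | tensor (f g : M) : CompTensorClosure t S f → CompTensorClosure t S g →
      CompTensorClosure t S (t f g)

/-- A semi-monoidal submonoid: a submonoid that is closed under the tensor and contains the
associator and its inverse. -/
structure IsSemiMonoidalSubmonoid (t : M → M → M) (a a' : M) (S : Submonoid M) : Prop where
  assoc_mem : a ∈ S
  inv_mem : a' ∈ S
  tensor_mem (f g : M) : f ∈ S → g ∈ S → t f g ∈ S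

/-- The Abramsky-Heunen Frobenius monoid of `(Δ, ∇) = (d, m)`: the smallest semi-monoidal submonoid
that contains `d` and `m`. -/
def ahfMonoid (t : M → M → M) (a a' d m : M) : Submonoid M :=
  sInf {S | IsSemiMonoidalSubmonoid t a a' S ∧ d ∈ S ∧ m ∈ S}

end SemiMonoidal

/-! ### The endomorphism monoid of a strictly reflexive object

In `End N` multiplication is composition in the usual order, `f * g = f ∘ g`. -/

section EndStrict

variable {C : Type u} [Category.{v} C] [MonoidalCategory C]

/-- The tensor of `C`, on the endomorphisms of an object with `N ⊗ N = N`. -/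
def endTensor {N : C} (h : N ⊗ N = N) (f g : End N) : End N :=
  eqToHom h.symm ≫ (f ⊗ₘ g) ≫ eqToHom h

/-- The associator `t_{N,N,N} : N ⊗ (N ⊗ N) ⟶ (N ⊗ N) ⊗ N`, as an automorphism of an object with
`N ⊗ N = N`. -/
def endAssociator {N : C} (h : N ⊗ N = N) : N ≅ N :=
  eqToIso ((congrArg (fun A => N ⊗ A) h).trans h).symm ≪≫ (α_ N N N).symm ≪≫
    eqToIso ((congrArg (fun A => A ⊗ N) h).trans h)

/-- The arrow `α = t_{N,N,N}` of `End N`. -/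
def endAssoc {N : C} (h : N ⊗ N = N) : End N := (endAssociator h).hom

/-- The arrow `α⁻¹` of `End N`. -/
def endAssocInv {N : C} (h : N ⊗ N = N) : End N := (endAssociator h).inv

variable [SymmetricCategory C] [CompactClosedCategory C]

open CompactClosedCategory

/-- The split arrow `N ⟶ N ⊗ N = N` of the standard Frobenius algebra at `N ≅ X* ⊗ X`. -/
def endSplit {N : C} (h : N ⊗ N = N) {X : C} (φ : dualObj X ⊗ X ≅ N) : End N :=
  φ.inv ≫ canonicalSplit X ≫ (φ.hom ⊗ₘ φ.hom) ≫ eqToHom h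

/-- The merge arrow `N = N ⊗ N ⟶ N` of the standard Frobenius algebra at `N ≅ X* ⊗ X`. -/
def endMerge {N : C} (h : N ⊗ N = N) {X : C} (φ : dualObj X ⊗ X ≅ N) : End N :=
  eqToHom h.symm ≫ (φ.inv ⊗ₘ φ.inv) ≫ canonicalMerge X ≫ φ.hom

/-- The standard Abramsky-Heunen Frobenius monoid at `N ≅ X* ⊗ X` (called simple when the scalars
are trivial). -/
def standardAHFMonoid {N : C} (h : N ⊗ N = N) {X : C} (φ : dualObj X ⊗ X ≅ N) :
    Submonoid (End N) :=
  ahfMonoid (endTensor h) (endAssoc h) (endAssocInv h) (endSplit h φ) (endMerge h φ)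

end EndStrict

/-! ### Thompson's group and the bicyclic monoid -/

/-- Thompson's group `F = ⟨x₀, x₁, … : xᵢ⁻¹ xⱼ xᵢ = xⱼ₊₁ for all i < j⟩`. -/
abbrev ThompsonF : Type :=
  PresentedGroup {w : FreeGroup ℕ | ∃ i j : ℕ, i < j ∧
    w = (FreeGroup.of i)⁻¹ * FreeGroup.of j * FreeGroup.of i * (FreeGroup.of (j + 1))⁻¹}

/-- The two generators of the bicyclic monoid. -/
inductive BicyclicGen : Type
  | s
  | r

/-- The relation `r s = 1`. -/
inductive BicyclicRel : FreeMonoid BicyclicGen → FreeMonoid BicyclicGen → Prop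
  | rel : BicyclicRel (FreeMonoid.of BicyclicGen.r * FreeMonoid.of BicyclicGen.s) 1

/-- The bicyclic monoid `⟨s, r : r s = 1⟩`. -/
abbrev BicyclicMonoid : Type := PresentedMonoid BicyclicRel

/-! ### Semi-monoidal monoids -/

section SemiMonoidalMonoid

variable {M : Type*} [Monoid M] {t : M → M → M} {a a' d m : M}

/-! Trivial scalars force `cup X ≫ cap X = 𝟙`, so the unit object is a retract of `X ⊗ X*`, hence of
`N`. Three facts follow. Tensoring with `1` is faithful on `End N`, because an arrow can be
recovered from its tensor by inserting the section and the retraction. Next, `∇Δ = 1`. Finally, `Δ∇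
= 1` would, by faithfulness, make `cup X` and `cap X` mutually inverse and `N` a unit object. So `Δ∇
≠ 1`, and in particular `End N` is not commutative. The Frobenius laws themselves are instances of
the interchange law.

Thompson's group: send `xₙ` to `1 ⊗ (⋯ ⊗ (1 ⊗ α))`. Naturality of `α` gives the relations, and the
pentagon puts `α ⊗ 1` in the image, so the image is closed under tensor (`range_thompsonHom`). For
injectivity, embed the monoid in itself at each vertex of the binary tree. The image of `xₙ`
intertwines these embeddings according to an action on vertices. Faithful tensoring and
non-commutativity make the embeddings at distinct vertices distinct (`pathEmbed_injective`), so
equal images act equally, and the action separates positive words (`word_eq_of_thompsonHom_eq`).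
Every group element is a quotient of two such words.

Bicyclic monoid: every element is some `sⁱ rʲ`, and any coincidence among the `dⁱ mʲ` would give `d`
a right inverse or `m` a left inverse, hence `d * m = 1`. -/

theorem CompTensorClosure.mono {S T : Set M} (h : S ⊆ T) {f : M}
    (hf : CompTensorClosure t S f) : CompTensorClosure t T f := by
  induction hf with
  | of f hf => exact .of f (h hf)
  | comp f g _ _ hf hg => exact .comp f g hf hg
  | tensor f g _ _ hf hg => exact .tensor f g hf hg

theorem ahfMonoid_eq_compTensorClosure (h : IsSemiMonoidalMonoid t a a') :
    (ahfMonoid t a a' d m : Set M) = {f | CompTensorClosure t {a, a', d, m} f} := by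
  ext f
  simp only [ahfMonoid, SetLike.mem_coe, Submonoid.mem_sInf, Set.mem_ofPred_eq]
  constructor
  · intro hf
    let S : Submonoid M :=
      { carrier := {f | CompTensorClosure t {a, a', d, m} f}
        mul_mem' := fun hf hg => .comp _ _ hf hg
        one_mem' := by
          -- The closure contains the identity because `1 = a * a'`.
          rw [← h.mul_inv]
          exact .comp _ _ (.of _ (by simp)) (.of _ (by simp)) }
    exact hf S ⟨⟨.of _ (by simp), .of _ (by simp), fun _ _ hf hg => .tensor _ _ hf hg⟩,
      .of _ (by simp), .of _ (by simp)⟩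
  · rintro hf S ⟨hS, hd, hm⟩
    induction hf with
    | of f hf =>
      rcases hf with rfl | rfl | rfl | rfl
      exacts [hS.assoc_mem, hS.inv_mem, hd, hm]
    | comp f g _ _ hf hg => exact S.mul_mem hf hg
    | tensor f g _ _ hf hg => exact hS.tensor_mem f g hf hg

/-! ### Embeddings at the vertices of the binary tree -/

/-- `M` embedded in itself at the vertex of the infinite binary tree reached by a path, where
`false` is left and `true` is right. -/
def pathEmbed (t : M → M → M) : List Bool → M → M
  | [], f => f
  | false :: s, f => t (pathEmbed t s f) 1
  | true :: s, f => t 1 (pathEmbed t s f)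

theorem IsSemiMonoidalMonoid.left_mul_right (h : IsSemiMonoidalMonoid t a a') (f g : M) :
    t f 1 * t 1 g = t f g := by
  rw [← h.tensor_mul, mul_one, one_mul]

theorem IsSemiMonoidalMonoid.right_mul_left (h : IsSemiMonoidalMonoid t a a') (f g : M) :
    t 1 g * t f 1 = t f g := by
  rw [← h.tensor_mul, mul_one, one_mul]

theorem pathEmbed_mul (h : IsSemiMonoidalMonoid t a a') (s : List Bool) (f g : M) :
    pathEmbed t s (f * g) = pathEmbed t s f * pathEmbed t s g := by
  induction s with
  | nil => rfl
  | cons b s ih => cases b <;> simp [pathEmbed, ih, ← h.tensor_mul]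

theorem eq_of_pathEmbed_eq (hr : ∀ f g, t 1 f = t 1 g → f = g)
    (hl : ∀ f g, t f 1 = t g 1 → f = g) (s : List Bool) {f g : M}
    (H : pathEmbed t s f = pathEmbed t s g) : f = g := by
  induction s with
  | nil => exact H
  | cons b s ih =>
    cases b
    · exact ih (hl _ _ H)
    · exact ih (hr _ _ H)

/-- Otherwise every element, even one of the form `t 1 f`, would also have the form `t _ 1` (or the
mirror image), and so would commute with every `t 1 g`. Faithfulness then makes `f` and `g` commute.
-/
theorem exists_pathEmbed_cons_ne (h : IsSemiMonoidalMonoid t a a')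
    (hr : ∀ f g, t 1 f = t 1 g → f = g) (hl : ∀ f g, t f 1 = t g 1 → f = g)
    (hc : ¬ ∀ f g : M, f * g = g * f) (b : Bool) (q : List Bool) :
    ∃ f, f ≠ pathEmbed t (b :: q) f := by
  by_contra! H
  cases b with
  | false =>
    refine hc fun f g => hr _ _ ?_
    have e : t 1 f = t (pathEmbed t q (t 1 f)) 1 := H (t 1 f)
    have k := (h.right_mul_left (pathEmbed t q (t 1 f)) g).trans (h.left_mul_right _ _).symm
    rw [← e, ← h.tensor_mul, ← h.tensor_mul, one_mul] at k
    exact k.symm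
  | true =>
    refine hc fun f g => hl _ _ ?_
    have e : t f 1 = t 1 (pathEmbed t q (t f 1)) := H (t f 1)
    have k := (h.right_mul_left g (pathEmbed t q (t f 1))).trans (h.left_mul_right _ _).symm
    rw [← e, ← h.tensor_mul, ← h.tensor_mul, one_mul] at k
    exact k

/-- Elements supported in opposite halves of the tree commute. If the two embeddings agreed, `f` and
`g` embedded at one and the same vertex would commute. -/
theorem exists_pathEmbed_left_ne_right (h : IsSemiMonoidalMonoid t a a')
    (hr : ∀ f g, t 1 f = t 1 g → f = g) (hl : ∀ f g, t f 1 = t g 1 → f = g)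
    (hc : ¬ ∀ f g : M, f * g = g * f) (p q : List Bool) :
    ∃ f, pathEmbed t (false :: p) f ≠ pathEmbed t (true :: q) f := by
  by_contra! H
  refine hc fun f g => eq_of_pathEmbed_eq hr hl (false :: p) ?_
  rw [pathEmbed_mul h, pathEmbed_mul h, H g]
  exact (h.left_mul_right _ _).trans (h.right_mul_left _ _).symm

/-- When tensoring is faithful and `M` is not commutative, the embedding determines the path. -/
theorem pathEmbed_injective (h : IsSemiMonoidalMonoid t a a')
    (hr : ∀ f g, t 1 f = t 1 g → f = g) (hl : ∀ f g, t f 1 = t g 1 → f = g)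
    (hc : ¬ ∀ f g : M, f * g = g * f) {p q : List Bool}
    (H : ∀ f, pathEmbed t p f = pathEmbed t q f) : p = q := by
  induction p generalizing q with
  | nil =>
    cases q with
    | nil => rfl
    | cons b q =>
      obtain ⟨f, hf⟩ := exists_pathEmbed_cons_ne h hr hl hc b q
      exact (hf (H f)).elim
  | cons b p ih =>
    cases q with
    | nil =>
      obtain ⟨f, hf⟩ := exists_pathEmbed_cons_ne h hr hl hc b p
      exact (hf (H f).symm).elim
    | cons c q =>
      cases b <;> cases c
      · exact congrArg _ (ih fun f => hl _ _ (H f))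
      · obtain ⟨f, hf⟩ := exists_pathEmbed_left_ne_right h hr hl hc p q
        exact (hf (H f)).elim
      · obtain ⟨f, hf⟩ := exists_pathEmbed_left_ne_right h hr hl hc q p
        exact (hf (H f).symm).elim
      · exact congrArg _ (ih fun f => hr _ _ (H f))

/-! ### The homomorphism from Thompson's group and its image -/

/-- The elements `a, 1 ⊗ a, 1 ⊗ (1 ⊗ a), …`. -/
def shiftedAssoc (t : M → M → M) (a : M) : ℕ → M
  | 0 => a
  | n + 1 => t 1 (shiftedAssoc t a n)

theorem IsSemiMonoidalMonoid.semiconj_zero (h : IsSemiMonoidalMonoid t a a') (f : M) :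
    t 1 f * a = a * t 1 (t 1 f) := by
  rw [h.naturality, h.tensor_one]

/-- For `i = 0` this is naturality of the associator in its third argument; applying `t 1` raises
all indices by one. -/
theorem shiftedAssoc_mul (h : IsSemiMonoidalMonoid t a a') {i j : ℕ} (hij : i < j) :
    shiftedAssoc t a j * shiftedAssoc t a i =
      shiftedAssoc t a i * shiftedAssoc t a (j + 1) := by
  induction i generalizing j with
  | zero =>
    obtain ⟨j, rfl⟩ := Nat.exists_eq_succ_of_ne_zero hij.ne'
    exact h.semiconj_zero _
  | succ i ih =>
    obtain ⟨j, rfl⟩ := Nat.exists_eq_succ_of_ne_zero (Nat.ne_zero_of_lt hij)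
    simp only [shiftedAssoc] at ih ⊢
    rw [← h.tensor_mul, ih (by omega), h.tensor_mul]

/-- The units `a, 1 ⊗ a, 1 ⊗ (1 ⊗ a), …`. -/
def shiftedAssocUnit (h : IsSemiMonoidalMonoid t a a') (n : ℕ) : Mˣ where
  val := shiftedAssoc t a n
  inv := shiftedAssoc t a' n
  val_inv := by
    induction n with
    | zero => exact h.mul_inv
    | succ n ih => simp [shiftedAssoc, ← h.tensor_mul, ih, h.tensor_one]
  inv_val := by
    induction n with
    | zero => exact h.inv_mul
    | succ n ih => simp [shiftedAssoc, ← h.tensor_mul, ih, h.tensor_one]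

/-- The generator `xₙ` of Thompson's group. -/
def ThompsonF.gen (n : ℕ) : ThompsonF := PresentedGroup.of n

theorem ThompsonF.gen_mul {i j : ℕ} (hij : i < j) :
    gen j * gen i = gen i * gen (j + 1) := by
  have e : (gen i)⁻¹ * gen j * gen i * (gen (j + 1))⁻¹ = 1 :=
    (PresentedGroup.one_of_mem (rels := {w : FreeGroup ℕ | ∃ i j : ℕ, i < j ∧
      w = (FreeGroup.of i)⁻¹ * FreeGroup.of j * FreeGroup.of i * (FreeGroup.of (j + 1))⁻¹})
      ⟨i, j, hij, rfl⟩)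
  rw [← mul_inv_eq_one.mp e]
  group

/-- The homomorphism `xₙ ↦ 1 ⊗ (⋯ ⊗ (1 ⊗ a))` from Thompson's group to the units. -/
def thompsonToUnits (h : IsSemiMonoidalMonoid t a a') : ThompsonF →* Mˣ :=
  PresentedGroup.toGroup (f := shiftedAssocUnit h) (by
    rintro _ ⟨i, j, hij, rfl⟩
    have e : shiftedAssocUnit h j * shiftedAssocUnit h i =
        shiftedAssocUnit h i * shiftedAssocUnit h (j + 1) := Units.ext (shiftedAssoc_mul h hij)
    simp only [map_mul, map_inv, FreeGroup.lift_apply_of]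
    rw [mul_assoc (_)⁻¹, e, inv_mul_cancel_left, mul_inv_cancel])

/-- The homomorphism `xₙ ↦ 1 ⊗ (⋯ ⊗ (1 ⊗ a))` from Thompson's group. -/
def thompsonHom (h : IsSemiMonoidalMonoid t a a') : ThompsonF →* M :=
  (Units.coeHom M).comp (thompsonToUnits h)

theorem thompsonHom_gen (h : IsSemiMonoidalMonoid t a a') (n : ℕ) :
    thompsonHom h (ThompsonF.gen n) = shiftedAssoc t a n := by
  simp [thompsonHom, thompsonToUnits, ThompsonF.gen, shiftedAssocUnit]

theorem thompsonHom_gen_inv (h : IsSemiMonoidalMonoid t a a') (n : ℕ) :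
    thompsonHom h (ThompsonF.gen n)⁻¹ = shiftedAssoc t a' n := by
  simp [thompsonHom, thompsonToUnits, ThompsonF.gen, shiftedAssocUnit]

theorem ThompsonF.induction {P : ThompsonF → Prop} (one : P 1)
    (gen_mul : ∀ n g, P g → P (gen n * g)) (inv_mul : ∀ n g, P g → P ((gen n)⁻¹ * g))
    (g : ThompsonF) : P g := by
  have hg : g ∈ Subgroup.closure (Set.range gen) := by
    have := PresentedGroup.closure_range_of {w : FreeGroup ℕ | ∃ i j : ℕ, i < j ∧
      w = (FreeGroup.of i)⁻¹ * FreeGroup.of j * FreeGroup.of i * (FreeGroup.of (j + 1))⁻¹}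
    change g ∈ Subgroup.closure (Set.range PresentedGroup.of)
    rw [this]
    trivial
  induction hg using Subgroup.closure_induction_left with
  | one => exact one
  | mul_left x hx y _ ih =>
    obtain ⟨n, rfl⟩ := hx
    exact gen_mul n y ih
  | inv_mul_cancel x hx y _ ih =>
    obtain ⟨n, rfl⟩ := hx
    exact inv_mul n y ih

theorem shiftedAssoc_compTensorClosure (h : IsSemiMonoidalMonoid t a a') (n : ℕ) :
    CompTensorClosure t {a, a'} (shiftedAssoc t a n) ∧
      CompTensorClosure t {a, a'} (shiftedAssoc t a' n) := by
  have one : CompTensorClosure t {a, a'} (1 : M) := by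
    rw [← h.mul_inv]
    exact .comp _ _ (.of _ (by simp)) (.of _ (by simp))
  induction n with
  | zero => exact ⟨.of _ (by simp [shiftedAssoc]), .of _ (by simp [shiftedAssoc])⟩
  | succ n ih => exact ⟨.tensor _ _ one ih.1, .tensor _ _ one ih.2⟩

theorem exists_thompsonHom_right (h : IsSemiMonoidalMonoid t a a') (g : ThompsonF) :
    ∃ g', thompsonHom h g' = t 1 (thompsonHom h g) := by
  induction g using ThompsonF.induction with
  | one => exact ⟨1, by simp [h.tensor_one]⟩
  | gen_mul n g ih =>
    obtain ⟨g', hg'⟩ := ih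
    refine ⟨ThompsonF.gen (n + 1) * g', ?_⟩
    rw [map_mul, map_mul, hg', thompsonHom_gen, thompsonHom_gen, shiftedAssoc,
      ← h.tensor_mul, one_mul]
  | inv_mul n g ih =>
    obtain ⟨g', hg'⟩ := ih
    refine ⟨(ThompsonF.gen (n + 1))⁻¹ * g', ?_⟩
    rw [map_mul, map_mul, hg', thompsonHom_gen_inv, thompsonHom_gen_inv, shiftedAssoc,
      ← h.tensor_mul, one_mul]

/-- The pentagon solved for `t a 1` gives `x₀ x₀ x₁⁻¹ x₀⁻¹`. For larger indices, naturality writes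
`(1 ⊗ f) ⊗ 1` as the conjugate by `a` of `1 ⊗ (f ⊗ 1)`. -/
theorem exists_thompsonHom_gen_left (h : IsSemiMonoidalMonoid t a a') (n : ℕ) :
    ∃ g, thompsonHom h g = t (shiftedAssoc t a n) 1 := by
  induction n with
  | zero =>
    refine ⟨ThompsonF.gen 0 * ThompsonF.gen 0 * (ThompsonF.gen 1)⁻¹ * (ThompsonF.gen 0)⁻¹, ?_⟩
    simp only [map_mul, thompsonHom_gen, thompsonHom_gen_inv, shiftedAssoc, ← h.pentagon]
    rw [mul_assoc (t a 1 * a), ← h.tensor_mul, h.mul_inv, mul_one, h.tensor_one, mul_one,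
      mul_assoc, h.mul_inv, mul_one]
  | succ n ih =>
    obtain ⟨g, hg⟩ := ih
    obtain ⟨g', hg'⟩ := exists_thompsonHom_right h g
    refine ⟨ThompsonF.gen 0 * g' * (ThompsonF.gen 0)⁻¹, ?_⟩
    rw [map_mul, map_mul, thompsonHom_gen, thompsonHom_gen_inv, hg', hg, shiftedAssoc,
      h.naturality, mul_assoc, shiftedAssoc, h.mul_inv, mul_one, shiftedAssoc]

theorem exists_thompsonHom_left (h : IsSemiMonoidalMonoid t a a') (g : ThompsonF) :
    ∃ g', thompsonHom h g' = t (thompsonHom h g) 1 := by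
  induction g using ThompsonF.induction with
  | one => exact ⟨1, by simp [h.tensor_one]⟩
  | gen_mul n g ih =>
    obtain ⟨g', hg'⟩ := ih
    obtain ⟨x, hx⟩ := exists_thompsonHom_gen_left h n
    refine ⟨x * g', ?_⟩
    rw [map_mul, map_mul, hg', hx, thompsonHom_gen, ← h.tensor_mul, one_mul]
  | inv_mul n g ih =>
    obtain ⟨g', hg'⟩ := ih
    obtain ⟨x, hx⟩ := exists_thompsonHom_gen_left h n
    refine ⟨x⁻¹ * g', ?_⟩
    have e : thompsonHom h x⁻¹ = t (shiftedAssoc t a' n) 1 := by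
      refine left_inv_eq_right_inv (a := thompsonHom h x) ?_ ?_
      · rw [← map_mul, inv_mul_cancel, map_one]
      rw [hx, ← h.tensor_mul, one_mul]
      refine Eq.trans ?_ h.tensor_one
      exact congrArg (t · 1) (shiftedAssocUnit h n).val_inv
    rw [map_mul, map_mul, hg', e, thompsonHom_gen_inv, ← h.tensor_mul, one_mul]

theorem range_thompsonHom (h : IsSemiMonoidalMonoid t a a') :
    Set.range (thompsonHom h) = {f | CompTensorClosure t {a, a'} f} := by
  ext f
  constructor
  · rintro ⟨g, rfl⟩
    change CompTensorClosure t {a, a'} _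
    induction g using ThompsonF.induction with
    | one =>
      rw [map_one, ← h.mul_inv]
      exact .comp _ _ (.of _ (by simp)) (.of _ (by simp))
    | gen_mul n g ih =>
      rw [map_mul, thompsonHom_gen]
      exact .comp _ _ (shiftedAssoc_compTensorClosure h n).1 ih
    | inv_mul n g ih =>
      rw [map_mul, thompsonHom_gen_inv]
      exact .comp _ _ (shiftedAssoc_compTensorClosure h n).2 ih
  · intro hf
    induction hf with
    | of f hf =>
      rcases hf with rfl | rfl
      · exact ⟨_, thompsonHom_gen h 0⟩
      · exact ⟨_, thompsonHom_gen_inv h 0⟩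
    | comp f g _ _ hf hg =>
      obtain ⟨x, rfl⟩ := hf
      obtain ⟨y, rfl⟩ := hg
      exact ⟨x * y, map_mul _ _ _⟩
    | tensor f g _ _ hf hg =>
      obtain ⟨x, rfl⟩ := hf
      obtain ⟨y, rfl⟩ := hg
      obtain ⟨x', hx⟩ := exists_thompsonHom_left h x
      obtain ⟨y', hy⟩ := exists_thompsonHom_right h y
      exact ⟨x' * y', by rw [map_mul, hx, hy, h.left_mul_right]⟩

/-! ### Fractions and positive words in Thompson's group -/

/-- The positive element of Thompson's group spelled by a word in the generators. -/
def ThompsonF.word (w : List ℕ) : ThompsonF := (w.map gen).prod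

theorem ThompsonF.word_cons (i : ℕ) (w : List ℕ) : word (i :: w) = gen i * word w :=
  List.prod_cons

theorem ThompsonF.gen_inv_mul_word (i : ℕ) (w : List ℕ) :
    ∃ v u, (gen i)⁻¹ * word w = word v * (word u)⁻¹ := by
  -- Moving right through a positive word, the inverse generator changes its index, changes that of
  -- the letter it passes, or cancels. At most one inverse letter survives, and this sharper form is
  -- what the induction carries.
  suffices H : ∃ v, (gen i)⁻¹ * word w = word v ∨
      ∃ j, (gen i)⁻¹ * word w = word v * (gen j)⁻¹ by
    obtain ⟨v, hv | ⟨j, hv⟩⟩ := H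
    · exact ⟨v, [], by simpa [word] using hv⟩
    · exact ⟨v, [j], by simpa [word] using hv⟩
  induction w generalizing i with
  | nil => exact ⟨[], .inr ⟨i, by simp [word]⟩⟩
  | cons k w ih =>
    have key : ∀ k' i', (gen i)⁻¹ * gen k = gen k' * (gen i')⁻¹ →
        ∃ v, (gen i)⁻¹ * word (k :: w) = word v ∨
          ∃ j, (gen i)⁻¹ * word (k :: w) = word v * (gen j)⁻¹ := by
      intro k' i' e
      obtain ⟨v, hv⟩ := ih i'
      refine ⟨k' :: v, ?_⟩
      rw [word_cons, word_cons, ← mul_assoc, e, mul_assoc]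
      rcases hv with hv | ⟨j, hv⟩
      · exact .inl (by rw [hv])
      · exact .inr ⟨j, by rw [hv, mul_assoc]⟩
    rcases lt_trichotomy i k with hik | rfl | hik
    · refine key (k + 1) i ?_
      rw [inv_mul_eq_iff_eq_mul, ← mul_assoc, ← gen_mul hik, mul_inv_cancel_right]
    · exact ⟨w, .inl (by rw [word_cons, inv_mul_cancel_left])⟩
    · refine key k (i + 1) ?_
      rw [inv_mul_eq_iff_eq_mul, ← mul_assoc, gen_mul hik, mul_inv_cancel_right]

theorem ThompsonF.exists_word_mul_inv (g : ThompsonF) : ∃ v u, g = word v * (word u)⁻¹ := by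
  induction g using ThompsonF.induction with
  | one => exact ⟨[], [], by simp [word]⟩
  | gen_mul n g ih =>
    obtain ⟨v, u, rfl⟩ := ih
    exact ⟨n :: v, u, by rw [word_cons, mul_assoc]⟩
  | inv_mul n g ih =>
    obtain ⟨v, u, rfl⟩ := ih
    obtain ⟨v', u', e⟩ := gen_inv_mul_word n v
    refine ⟨v', u ++ u', ?_⟩
    rw [← mul_assoc, e]
    simp [word, mul_assoc]

/-- A least letter is brought to the front by `xⱼ xᵢ = xᵢ xⱼ₊₁` for `i < j`. Preservation of length
lets later arguments induct on it. -/
theorem ThompsonF.exists_word_cons_eq (j : ℕ) (w : List ℕ) :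
    ∃ i v, word (j :: w) = word (i :: v) ∧ v.length = w.length ∧ ∀ k ∈ v, i ≤ k := by
  induction w generalizing j with
  | nil => exact ⟨j, [], rfl, rfl, by simp⟩
  | cons k w ih =>
    obtain ⟨i, v, e, hl, hv⟩ := ih k
    rcases le_or_gt j i with hji | hij
    · refine ⟨j, i :: v, by rw [word_cons, e, word_cons j], by simp [hl], ?_⟩
      simpa [hji] using fun l hlv => hji.trans (hv l hlv)
    · refine ⟨i, (j + 1) :: v, ?_, by simp [hl], ?_⟩
      · rw [word_cons, e, word_cons, word_cons, word_cons, ← mul_assoc, gen_mul hij, mul_assoc]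
      · simpa using ⟨by omega, hv⟩

/-! ### The action on vertices of the binary tree -/

/-- The action of `xₙ` on the vertices of the infinite binary tree that are not on its rightmost
branch, where `(k, s)` stands for the vertex reached by going `k` times right, once left and
then along `s`. -/
def vertexShift : ℕ → ℕ × List Bool → ℕ × List Bool
  | 0, (0, s) => (0, false :: s)
  | 0, (1, s) => (0, true :: s)
  | 0, (k + 2, s) => (k + 1, s)
  | _ + 1, (0, s) => (0, s)
  | n + 1, (k + 1, s) => ((vertexShift n (k, s)).1 + 1, (vertexShift n (k, s)).2)

/-- The path from the root to a vertex that is not on the rightmost branch. -/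
def vertexPath : ℕ × List Bool → List Bool
  | (0, s) => false :: s
  | (k + 1, s) => true :: vertexPath (k, s)

theorem vertexPath_injective : Function.Injective vertexPath := by
  rintro ⟨k, s⟩ ⟨l, s'⟩ H
  induction k generalizing l with
  | zero => cases l <;> simp_all [vertexPath]
  | succ k ih =>
    cases l with
    | zero => simp [vertexPath] at H
    | succ l =>
      have := ih l (by simpa [vertexPath] using H)
      simp_all

/-- The three cases for `n = 0` are naturality of the associator in its first, second and third
argument. For `n + 1` and `k = 0` the two factors live in opposite halves and commute. -/
theorem shiftedAssoc_mul_pathEmbed (h : IsSemiMonoidalMonoid t a a') (n : ℕ)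
    (p : ℕ × List Bool) (f : M) :
    shiftedAssoc t a n * pathEmbed t (vertexPath p) f =
      pathEmbed t (vertexPath (vertexShift n p)) f * shiftedAssoc t a n := by
  obtain ⟨k, s⟩ := p
  induction n generalizing k with
  | zero =>
    match k with
    | 0 =>
      simp only [vertexShift, vertexPath, pathEmbed, shiftedAssoc]
      rw [← h.naturality, h.tensor_one]
    | 1 =>
      simp only [vertexShift, vertexPath, pathEmbed, shiftedAssoc]
      exact h.naturality 1 (pathEmbed t s f) 1
    | k + 2 =>
      simp only [vertexShift, vertexPath, pathEmbed, shiftedAssoc]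
      exact (h.semiconj_zero (pathEmbed t (vertexPath (k, s)) f)).symm
  | succ n ih =>
    match k with
    | 0 =>
      simp only [vertexShift, vertexPath, pathEmbed, shiftedAssoc]
      exact (h.right_mul_left (pathEmbed t s f) (shiftedAssoc t a n)).trans
        (h.left_mul_right _ _).symm
    | k + 1 =>
      simp only [vertexShift, vertexPath, pathEmbed, shiftedAssoc, ← h.tensor_mul]
      rw [ih]

theorem vertexShift_of_lt {k n : ℕ} (hk : k < n) (s : List Bool) :
    vertexShift n (k, s) = (k, s) := by
  induction n generalizing k with
  | zero => omega
  | succ n ih =>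
    cases k with
    | zero => rfl
    | succ k => simp [vertexShift, ih (k := k) (by omega)]

theorem vertexShift_self (n : ℕ) (s : List Bool) :
    vertexShift n (n, s) = (n, false :: s) := by
  induction n with
  | zero => rfl
  | succ n ih => simp [vertexShift, ih]

theorem thompsonHom_word_mul_pathEmbed (h : IsSemiMonoidalMonoid t a a') (w : List ℕ)
    (p : ℕ × List Bool) (f : M) :
    thompsonHom h (ThompsonF.word w) * pathEmbed t (vertexPath p) f =
      pathEmbed t (vertexPath (w.foldr vertexShift p)) f * thompsonHom h (ThompsonF.word w) := by
  induction w with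
  | nil => simp [ThompsonF.word]
  | cons n w ih =>
    rw [ThompsonF.word_cons, map_mul, mul_assoc, ih, ← mul_assoc, thompsonHom_gen,
      shiftedAssoc_mul_pathEmbed h, mul_assoc, List.foldr_cons]

theorem foldr_vertexShift_of_lt {w : List ℕ} {k : ℕ} (hw : ∀ n ∈ w, k < n) (s : List Bool) :
    w.foldr vertexShift (k, s) = (k, s) := by
  induction w with
  | nil => rfl
  | cons n w ih =>
    rw [List.foldr_cons, ih fun l hl => hw l (by simp [hl]), vertexShift_of_lt (hw n (by simp))]

theorem foldr_vertexShift_of_le {w : List ℕ} {k : ℕ} (hw : ∀ n ∈ w, k ≤ n) (s : List Bool) :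
    ∃ s', w.foldr vertexShift (k, s) = (k, s') := by
  induction w with
  | nil => exact ⟨s, rfl⟩
  | cons n w ih =>
    obtain ⟨s', e⟩ := ih fun l hl => hw l (by simp [hl])
    rw [List.foldr_cons, e]
    rcases (hw n (by simp)).lt_or_eq with hk | rfl
    · exact ⟨s', vertexShift_of_lt hk s'⟩
    · exact ⟨_, vertexShift_self _ _⟩

/-- The letters of `w` keep the vertex below the `k`-th left turn. The letter `k`, which acts last,
then prepends `false`, so the path cannot be empty. -/
theorem foldr_vertexShift_cons {w : List ℕ} {k : ℕ} (hw : ∀ n ∈ w, k ≤ n) :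
    (k :: w).foldr vertexShift (k, []) ≠ (k, []) := by
  obtain ⟨s', e⟩ := foldr_vertexShift_of_le hw []
  rw [List.foldr_cons, e, vertexShift_self]
  simp

/-! ### Injectivity on Thompson's group -/

theorem isUnit_thompsonHom (h : IsSemiMonoidalMonoid t a a') (g : ThompsonF) :
    IsUnit (thompsonHom h g) :=
  ⟨thompsonToUnits h g, rfl⟩

theorem foldr_vertexShift_eq (h : IsSemiMonoidalMonoid t a a')
    (hr : ∀ f g, t 1 f = t 1 g → f = g) (hl : ∀ f g, t f 1 = t g 1 → f = g)
    (hc : ¬ ∀ f g : M, f * g = g * f) {v w : List ℕ}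
    (H : thompsonHom h (ThompsonF.word v) = thompsonHom h (ThompsonF.word w))
    (p : ℕ × List Bool) : v.foldr vertexShift p = w.foldr vertexShift p := by
  refine vertexPath_injective (pathEmbed_injective h hr hl hc fun f => ?_)
  refine (isUnit_thompsonHom h (ThompsonF.word v)).mul_right_cancel ?_
  rw [← thompsonHom_word_mul_pathEmbed, H, ← thompsonHom_word_mul_pathEmbed]

/-- Both words are rewritten with a least letter in front. If these letters differ, the vertex `(i,
[])` for the smaller one is moved by its word and fixed by the other. If they agree, they cancel and
induction on length applies. -/
theorem word_eq_of_thompsonHom_eq (h : IsSemiMonoidalMonoid t a a')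
    (hr : ∀ f g, t 1 f = t 1 g → f = g) (hl : ∀ f g, t f 1 = t g 1 → f = g)
    (hc : ¬ ∀ f g : M, f * g = g * f) {v w : List ℕ}
    (H : thompsonHom h (ThompsonF.word v) = thompsonHom h (ThompsonF.word w)) :
    ThompsonF.word v = ThompsonF.word w := by
  induction hn : v.length generalizing v w with
  | zero =>
    obtain rfl := List.length_eq_zero_iff.mp hn
    cases w with
    | nil => rfl
    | cons j w =>
      obtain ⟨i, w', e, -, hw⟩ := ThompsonF.exists_word_cons_eq j w
      rw [e] at H
      exact (foldr_vertexShift_cons hw (foldr_vertexShift_eq h hr hl hc H _).symm).elim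
  | succ n ih =>
    cases v with
    | nil => simp at hn
    | cons k v =>
      obtain ⟨i, v', e, hlen, hv⟩ := ThompsonF.exists_word_cons_eq k v
      rw [e] at H ⊢
      cases w with
      | nil => exact (foldr_vertexShift_cons hv (foldr_vertexShift_eq h hr hl hc H _)).elim
      | cons k' w =>
        obtain ⟨j, w', e', -, hw⟩ := ThompsonF.exists_word_cons_eq k' w
        rw [e'] at H ⊢
        have act := foldr_vertexShift_eq h hr hl hc H
        rcases lt_trichotomy i j with hij | rfl | hij
        · refine (foldr_vertexShift_cons hv ((act _).trans (foldr_vertexShift_of_lt ?_ _))).elim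
          simpa [hij] using fun l hlw => hij.trans_le (hw l hlw)
        · rw [ThompsonF.word_cons, ThompsonF.word_cons, map_mul, map_mul] at H
          rw [ThompsonF.word_cons, ThompsonF.word_cons,
            ih ((isUnit_thompsonHom h _).mul_left_cancel H) (by simpa [hlen] using hn)]
        · refine (foldr_vertexShift_cons hw
            ((act _).symm.trans (foldr_vertexShift_of_lt ?_ _))).elim
          simpa [hij] using fun l hlv => hij.trans_le (hv l hlv)

theorem thompsonHom_injective (h : IsSemiMonoidalMonoid t a a')
    (hr : ∀ f g, t 1 f = t 1 g → f = g) (hl : ∀ f g, t f 1 = t g 1 → f = g)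
    (hc : ¬ ∀ f g : M, f * g = g * f) : Function.Injective (thompsonHom h) := by
  have inj : Function.Injective (thompsonToUnits h) := by
    rw [injective_iff_map_eq_one]
    intro g hg
    obtain ⟨v, u, rfl⟩ := ThompsonF.exists_word_mul_inv g
    rw [map_mul, map_inv, mul_inv_eq_one] at hg
    rw [mul_inv_eq_one]
    exact word_eq_of_thompsonHom_eq h hr hl hc (congrArg Units.val hg)
  exact Units.val_injective.comp inj

end SemiMonoidalMonoid

/-! ### The bicyclic monoid -/

section Bicyclic

variable {M : Type*} [Monoid M] {d m : M}

/-- The homomorphism from the bicyclic monoid with `s ↦ d` and `r ↦ m`. -/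
def bicyclicHom (h : m * d = 1) : BicyclicMonoid →* M :=
  PresentedMonoid.lift
    (fun g => match g with
      | .s => d
      | .r => m)
    (by rintro _ _ ⟨⟩; simpa using h)

theorem bicyclicHom_s (h : m * d = 1) :
    bicyclicHom h (PresentedMonoid.of BicyclicRel .s) = d := by
  simp [bicyclicHom]

theorem bicyclicHom_r (h : m * d = 1) :
    bicyclicHom h (PresentedMonoid.of BicyclicRel .r) = m := by
  simp [bicyclicHom]

theorem BicyclicMonoid.r_mul_s :
    (PresentedMonoid.of BicyclicRel .r * PresentedMonoid.of BicyclicRel .s : BicyclicMonoid) = 1 :=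
  Quotient.sound (ConGen.Rel.of _ _ BicyclicRel.rel)

theorem BicyclicMonoid.closure_eq_top :
    Submonoid.closure {PresentedMonoid.of BicyclicRel .s, PresentedMonoid.of BicyclicRel .r} = ⊤ := by
  rw [← PresentedMonoid.closure_range_of BicyclicRel]
  congr 1
  ext x
  constructor
  · rintro (rfl | rfl)
    exacts [⟨_, rfl⟩, ⟨_, rfl⟩]
  · rintro ⟨_ | _, rfl⟩ <;> simp

theorem BicyclicMonoid.exists_eq_pow_mul_pow (x : BicyclicMonoid) :
    ∃ i j : ℕ, x = PresentedMonoid.of BicyclicRel .s ^ i * PresentedMonoid.of BicyclicRel .r ^ j := by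
  have hx : x ∈ Submonoid.closure
      {PresentedMonoid.of BicyclicRel .s, PresentedMonoid.of BicyclicRel .r} := by
    rw [closure_eq_top]
    trivial
  induction hx using Submonoid.closure_induction_left with
  | one => exact ⟨0, 0, by simp⟩
  | mul_left y hy z _ ih =>
    obtain ⟨i, j, rfl⟩ := ih
    rcases hy with rfl | rfl
    · exact ⟨i + 1, j, by rw [pow_succ', mul_assoc]⟩
    · cases i with
      | zero => exact ⟨0, j + 1, by simp [pow_succ']⟩
      | succ i => exact ⟨i, j, by rw [pow_succ', ← mul_assoc, ← mul_assoc, r_mul_s, one_mul]⟩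

theorem pow_mul_pow_eq_one_of_mul_eq_one (h : m * d = 1) (n : ℕ) : m ^ n * d ^ n = 1 := by
  induction n with
  | zero => simp
  | succ n ih => rw [pow_succ, pow_succ', mul_assoc, ← mul_assoc m, h, one_mul, ih]

theorem mul_eq_one_of_right_inv (h : m * d = 1) {y : M} (hy : d * y = 1) :
    d * m = 1 := by
  rw [left_inv_eq_right_inv h hy, hy]

theorem mul_eq_one_of_left_inv (h : m * d = 1) {y : M} (hy : y * m = 1) :
    d * m = 1 := by
  rw [← left_inv_eq_right_inv hy h, hy]

/-- Cancelling `m ^ i` on the left and `d ^ j` on the right of an equality would exhibit a right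
inverse of `d`. -/
theorem pow_mul_pow_ne (h : m * d = 1) (hne : d * m ≠ 1) {i j k l : ℕ} (hik : i < k) :
    d ^ i * m ^ j ≠ d ^ k * m ^ l := by
  intro H
  obtain ⟨c, rfl⟩ := Nat.exists_eq_add_of_lt hik
  have hp : ∀ n : ℕ, m ^ n * d ^ n = 1 := pow_mul_pow_eq_one_of_mul_eq_one h
  refine hne (mul_eq_one_of_right_inv h (y := d ^ c * m ^ l * d ^ j) ?_)
  calc d * (d ^ c * m ^ l * d ^ j) = (m ^ i * d ^ i) * d ^ (c + 1) * m ^ l * d ^ j := by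
        rw [hp, pow_succ']; simp only [mul_assoc, one_mul]
    _ = m ^ i * (d ^ (i + c + 1) * m ^ l) * d ^ j := by
        rw [add_assoc, pow_add d i]; simp only [mul_assoc]
    _ = 1 := by rw [← H, ← mul_assoc (m ^ i), hp, one_mul, hp]

theorem pow_ne_pow (h : m * d = 1) (hne : d * m ≠ 1) {j l : ℕ} (hjl : j < l) :
    m ^ j ≠ m ^ l := by
  intro H
  obtain ⟨c, rfl⟩ := Nat.exists_eq_add_of_lt hjl
  have hp : m ^ j * d ^ j = 1 := pow_mul_pow_eq_one_of_mul_eq_one h j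
  refine hne (mul_eq_one_of_left_inv h (y := m ^ c) ?_)
  rw [← hp, H, add_assoc, add_comm j, pow_add, mul_assoc, hp, mul_one, pow_succ]

theorem bicyclicHom_injective (h : m * d = 1) (hne : d * m ≠ 1) :
    Function.Injective (bicyclicHom h) := by
  intro x y H
  obtain ⟨i, j, rfl⟩ := BicyclicMonoid.exists_eq_pow_mul_pow x
  obtain ⟨k, l, rfl⟩ := BicyclicMonoid.exists_eq_pow_mul_pow y
  simp only [map_mul, map_pow, bicyclicHom_s, bicyclicHom_r] at H
  obtain rfl : i = k := by
    by_contra hik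
    rcases lt_or_gt_of_ne hik with hik | hik
    exacts [pow_mul_pow_ne h hne hik H, pow_mul_pow_ne h hne hik H.symm]
  have H' := congrArg (m ^ i * ·) H
  simp only [← mul_assoc, pow_mul_pow_eq_one_of_mul_eq_one h, one_mul] at H'
  obtain rfl : j = l := by
    by_contra hjl
    rcases lt_or_gt_of_ne hjl with hjl | hjl
    exacts [pow_ne_pow h hne hjl H', pow_ne_pow h hne hjl H'.symm]
  rfl

theorem mrange_bicyclicHom (h : m * d = 1) :
    MonoidHom.mrange (bicyclicHom h) = Submonoid.closure {d, m} := by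
  rw [MonoidHom.mrange_eq_map, ← BicyclicMonoid.closure_eq_top, MonoidHom.map_mclosure,
    Set.image_pair, bicyclicHom_s, bicyclicHom_r]

end Bicyclic

/-! ### Transport along an isomorphism `N ⊗ N ≅ N` -/

section SelfSimilar

variable {C : Type u} [Category.{v} C] [MonoidalCategory C] {N : C}

theorem endTensor_eq (h : N ⊗ N = N) (f g : End N) :
    endTensor h f g = (eqToIso h).inv ≫ (f ⊗ₘ g) ≫ (eqToIso h).hom := rfl

theorem endAssoc_eq (h : N ⊗ N = N) :
    endAssoc h = (eqToIso h).inv ≫ N ◁ (eqToIso h).inv ≫ (α_ N N N).inv ≫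
      (eqToIso h).hom ▷ N ≫ (eqToIso h).hom := by
  simp [endAssoc, endAssociator]

theorem endAssocInv_eq (h : N ⊗ N = N) :
    endAssocInv h = (eqToIso h).inv ≫ (eqToIso h).inv ▷ N ≫ (α_ N N N).hom ≫
      N ◁ (eqToIso h).hom ≫ (eqToIso h).hom := by
  simp [endAssocInv, endAssociator]

/-- Stated for an arbitrary isomorphism `e`, so that no cast along an equality of objects has to be
moved through a tensor. -/
theorem selfSimilar_naturality (e : N ⊗ N ≅ N) (f g k : N ⟶ N) :
    (e.inv ≫ (f ⊗ₘ (e.inv ≫ (g ⊗ₘ k) ≫ e.hom)) ≫ e.hom) ≫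
        e.inv ≫ N ◁ e.inv ≫ (α_ N N N).inv ≫ e.hom ▷ N ≫ e.hom =
      (e.inv ≫ N ◁ e.inv ≫ (α_ N N N).inv ≫ e.hom ▷ N ≫ e.hom) ≫
        e.inv ≫ ((e.inv ≫ (f ⊗ₘ g) ≫ e.hom) ⊗ₘ k) ≫ e.hom := by
  have h₁ : (f ⊗ₘ (e.inv ≫ (g ⊗ₘ k) ≫ e.hom)) ≫ N ◁ e.inv = N ◁ e.inv ≫ (f ⊗ₘ (g ⊗ₘ k)) := by
    simp [← id_tensorHom, tensorHom_comp_tensorHom]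
  have h₂ : e.hom ▷ N ≫ ((e.inv ≫ (f ⊗ₘ g) ≫ e.hom) ⊗ₘ k) = ((f ⊗ₘ g) ⊗ₘ k) ≫ e.hom ▷ N := by
    simp only [← tensorHom_id, tensorHom_comp_tensorHom, Iso.hom_inv_id_assoc,
      Category.id_comp, Category.comp_id]
  simp only [Category.assoc, Iso.hom_inv_id_assoc]
  rw [reassoc_of% h₁, reassoc_of% h₂, associator_inv_naturality_assoc]

theorem selfSimilar_pentagon (e : N ⊗ N ≅ N) :
    (e.inv ≫ N ◁ (e.inv ≫ N ◁ e.inv ≫ (α_ N N N).inv ≫ e.hom ▷ N ≫ e.hom) ≫ e.hom) ≫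
        (e.inv ≫ N ◁ e.inv ≫ (α_ N N N).inv ≫ e.hom ▷ N ≫ e.hom) ≫
        e.inv ≫ (e.inv ≫ N ◁ e.inv ≫ (α_ N N N).inv ≫ e.hom ▷ N ≫ e.hom) ▷ N ≫ e.hom =
      (e.inv ≫ N ◁ e.inv ≫ (α_ N N N).inv ≫ e.hom ▷ N ≫ e.hom) ≫
        e.inv ≫ N ◁ e.inv ≫ (α_ N N N).inv ≫ e.hom ▷ N ≫ e.hom := by
  simp only [Category.assoc, Iso.hom_inv_id_assoc]
  rw [← whisker_exchange_assoc e.hom e.inv]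
  simp

theorem isSemiMonoidalMonoid_endTensor (h : N ⊗ N = N) :
    IsSemiMonoidalMonoid (endTensor h) (endAssoc h) (endAssocInv h) where
  tensor_one := by simp [endTensor_eq, End.one_def]
  tensor_mul f g f' g' := by simp [endTensor_eq, End.mul_def]
  mul_inv := (endAssociator h).inv_hom_id
  inv_mul := (endAssociator h).hom_inv_id
  naturality f g k := by
    simp only [endTensor_eq, End.mul_def, endAssoc_eq]
    exact selfSimilar_naturality _ f g k
  pentagon := by
    simp only [endTensor_eq, End.mul_def, endAssoc_eq, End.one_def, id_tensorHom, tensorHom_id]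
    exact selfSimilar_pentagon _

theorem isAHFrobenius_of_iso (h : N ⊗ N = N) {A : C} (φ : A ≅ N) {s : A ⟶ A ⊗ A}
    {r : A ⊗ A ⟶ A} (left : s ▷ A ≫ (α_ A A A).hom ≫ A ◁ r = r ≫ s)
    (right : A ◁ s ≫ (α_ A A A).inv ≫ r ▷ A = r ≫ s)
    (assoc : A ◁ r ≫ r = (α_ A A A).inv ≫ r ▷ A ≫ r)
    (coassoc : s ≫ A ◁ s ≫ (α_ A A A).inv = s ≫ s ▷ A) :
    IsAHFrobenius (endTensor h) (endAssoc h) (endAssocInv h)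
      (φ.inv ≫ s ≫ (φ.hom ⊗ₘ φ.hom) ≫ eqToHom h)
      (eqToHom h.symm ≫ (φ.inv ⊗ₘ φ.inv) ≫ r ≫ φ.hom) := by
  have e₁ : eqToHom h = (eqToIso h).hom := rfl
  have e₂ : eqToHom h.symm = (eqToIso h).inv := rfl
  constructor <;>
    simp only [endTensor_eq, End.mul_def, endAssoc_eq, endAssocInv_eq, End.one_def, e₁, e₂] <;>
    -- From here the equality `N ⊗ N = N` is only an isomorphism, and each law is the given one
    -- conjugated by tensor powers of `φ`.
    generalize eqToIso h = e
  · have := congrArg (fun f => e.inv ≫ (φ.inv ⊗ₘ φ.inv) ≫ f ≫ (φ.hom ⊗ₘ φ.hom) ≫ e.hom) left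
    simp [MonoidalCategory.tensorHom_def] at this ⊢
    rw [← this, associator_naturality_left_assoc, ← whisker_exchange_assoc φ.hom (A ◁ φ.inv)]
    simp [whisker_exchange_assoc]
  · have := congrArg (fun f => e.inv ≫ (φ.inv ⊗ₘ φ.inv) ≫ f ≫ (φ.hom ⊗ₘ φ.hom) ≫ e.hom) right
    simp [MonoidalCategory.tensorHom_def'] at this ⊢
    rw [← this, associator_inv_naturality_right_assoc, whisker_exchange_assoc (φ.inv ▷ A) φ.hom]
    simp [← whisker_exchange_assoc]
  · have := congrArg (fun f => e.inv ≫ N ◁ e.inv ≫ (φ.inv ⊗ₘ (φ.inv ⊗ₘ φ.inv)) ≫ f ≫ φ.hom) assoc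
    simp [MonoidalCategory.tensorHom_def] at this ⊢
    rw [← whisker_exchange_assoc r φ.inv, whisker_exchange_assoc φ.inv φ.hom,
      whisker_exchange_assoc φ.inv r, whisker_exchange_assoc φ.inv (A ◁ φ.inv),
      whisker_exchange_assoc φ.inv (φ.inv ▷ N)]
    simp [this]
  · have := congrArg (fun f => φ.inv ≫ f ≫ ((φ.hom ⊗ₘ φ.hom) ⊗ₘ φ.hom) ≫ e.hom ▷ N ≫ e.hom)
      coassoc
    simp [MonoidalCategory.tensorHom_def] at this ⊢
    rw [whisker_exchange_assoc φ.inv φ.hom, ← whisker_exchange_assoc φ.hom s,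
      hom_inv_whiskerRight_assoc, whisker_exchange_assoc s φ.hom,
      whisker_exchange_assoc (φ.hom ▷ A) φ.hom]
    have hx := congrArg (N ◁ ·) (whisker_exchange φ.hom φ.hom)
    simp only [MonoidalCategory.whiskerLeft_comp] at hx
    simp [this, reassoc_of% hx]

end SelfSimilar

/-! ### The canonical Frobenius algebra -/

section Canonical

variable {C : Type u} [Category.{v} C] [MonoidalCategory C] {X Y : C}
  (η : 𝟙_ C ⟶ X ⊗ Y) (ε : X ⊗ Y ⟶ 𝟙_ C)

/-- The arrow `1_Y ⊗ η ⊗ 1_X`. -/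
def innerSplit : Y ⊗ X ⟶ (Y ⊗ X) ⊗ (Y ⊗ X) :=
  Y ◁ (λ_ X).inv ≫ Y ◁ (η ▷ X) ≫ Y ◁ (α_ X Y X).hom ≫ (α_ Y X (Y ⊗ X)).inv

/-- The arrow `1_Y ⊗ ε ⊗ 1_X`. -/
def innerMerge : (Y ⊗ X) ⊗ (Y ⊗ X) ⟶ Y ⊗ X :=
  (α_ Y X (Y ⊗ X)).hom ≫ Y ◁ (α_ X Y X).inv ≫ Y ◁ (ε ▷ X) ≫ Y ◁ (λ_ X).hom

/-- As in the three laws after it, both sides apply two arrows on disjoint strands in opposite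
orders. The interchange law swaps them, and the rest is coherence. -/
theorem innerSplit_innerMerge_left :
    innerSplit η ▷ (Y ⊗ X) ≫ (α_ _ _ _).hom ≫ (Y ⊗ X) ◁ innerMerge ε =
      innerMerge ε ≫ innerSplit η := by
  simp only [innerSplit, innerMerge]
  have h := whisker_exchange η ε
  calc _ = 𝟙 _ ⊗≫ Y ◁ ((𝟙_ C ◁ ε ≫ η ▷ 𝟙_ C) ▷ X) ⊗≫ 𝟙 _ := by
        rw [h]; monoidal
    _ = _ := by monoidal

theorem innerSplit_innerMerge_right :
    (Y ⊗ X) ◁ innerSplit η ≫ (α_ _ _ _).inv ≫ innerMerge ε ▷ (Y ⊗ X) =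
      innerMerge ε ≫ innerSplit η := by
  simp only [innerSplit, innerMerge]
  have h := whisker_exchange ε η
  calc _ = 𝟙 _ ⊗≫ Y ◁ (((X ⊗ Y) ◁ η ≫ ε ▷ (X ⊗ Y)) ▷ X) ⊗≫ 𝟙 _ := by
        monoidal
    _ = _ := by rw [h]; monoidal

theorem innerMerge_assoc :
    (Y ⊗ X) ◁ innerMerge ε ≫ innerMerge ε =
      (α_ _ _ _).inv ≫ innerMerge ε ▷ (Y ⊗ X) ≫ innerMerge ε := by
  simp only [innerMerge]
  have h := whisker_exchange ε ε
  calc _ = 𝟙 _ ⊗≫ Y ◁ (((X ⊗ Y) ◁ ε ≫ ε ▷ 𝟙_ C) ▷ X) ⊗≫ 𝟙 _ := by monoidal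
    _ = _ := by rw [h]; monoidal

theorem innerSplit_coassoc :
    innerSplit η ≫ (Y ⊗ X) ◁ innerSplit η ≫ (α_ _ _ _).inv =
      innerSplit η ≫ innerSplit η ▷ (Y ⊗ X) := by
  simp only [innerSplit]
  have h := whisker_exchange η η
  calc _ = 𝟙 _ ⊗≫ Y ◁ ((η ▷ 𝟙_ C ≫ (X ⊗ Y) ◁ η) ▷ X) ⊗≫ 𝟙 _ := by monoidal
    _ = _ := by rw [← h]; monoidal

theorem innerSplit_innerMerge (h : η ≫ ε = 𝟙 _) : innerSplit η ≫ innerMerge ε = 𝟙 (Y ⊗ X) := by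
  calc _ = 𝟙 _ ⊗≫ Y ◁ ((η ≫ ε) ▷ X) ⊗≫ 𝟙 _ := by
        simp only [innerSplit, innerMerge]
        monoidal
    _ = _ := by
        rw [h]
        monoidal

variable {η ε}

/-- `f` is recovered from `Y ◁ f` by whiskering with `X`, then creating `X ⊗ Y` with `η` and
removing it with `ε`. -/
theorem whiskerLeft_injective_of_retract (h : η ≫ ε = 𝟙 _) {A B : C} {f g : A ⟶ B}
    (H : Y ◁ f = Y ◁ g) : f = g := by
  have key : ∀ f : A ⟶ B,
      f = (λ_ A).inv ≫ η ▷ A ≫ (α_ X Y A).hom ≫ X ◁ Y ◁ f ≫ (α_ X Y B).inv ≫ ε ▷ B ≫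
        (λ_ B).hom := by
    intro f
    rw [associator_inv_naturality_right_assoc, Iso.hom_inv_id_assoc, whisker_exchange_assoc,
      ← comp_whiskerRight_assoc, h]
    simp
  rw [key f, key g, H]

theorem whiskerRight_injective_of_retract (h : η ≫ ε = 𝟙 _) {A B : C} {f g : A ⟶ B}
    (H : f ▷ X = g ▷ X) : f = g := by
  have key : ∀ f : A ⟶ B,
      f = (ρ_ A).inv ≫ A ◁ η ≫ (α_ A X Y).inv ≫ f ▷ X ▷ Y ≫ (α_ B X Y).hom ≫ B ◁ ε ≫
        (ρ_ B).hom := by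
    intro f
    rw [associator_naturality_left_assoc, Iso.inv_hom_id_assoc, ← whisker_exchange_assoc,
      ← MonoidalCategory.whiskerLeft_comp_assoc, h]
    simp
  rw [key f, key g, H]

/-- Up to coherence the composite in `h'` is `Y ◁ (ε ≫ η) ▷ X`, from which both whiskerings can be
stripped. -/
theorem comp_eq_id_of_innerMerge_innerSplit (h : η ≫ ε = 𝟙 _)
    (h' : innerMerge ε ≫ innerSplit η = 𝟙 _) : ε ≫ η = 𝟙 _ := by
  refine whiskerRight_injective_of_retract h (whiskerLeft_injective_of_retract h ?_)
  calc Y ◁ (ε ≫ η) ▷ X = 𝟙 _ ⊗≫ (innerMerge ε ≫ innerSplit η) ⊗≫ 𝟙 _ := by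
        simp only [innerSplit, innerMerge]
        monoidal
    _ = _ := by
        rw [h']
        monoidal

end Canonical

/-! ### Application to strictly reflexive objects -/

section Main

open CompactClosedCategory

variable {C : Type u} [Category.{v} C] [MonoidalCategory C] {N : C}

theorem endTensor_one_left_injective (h : N ⊗ N = N) {η : 𝟙_ C ⟶ N} {ε : N ⟶ 𝟙_ C}
    (hε : η ≫ ε = 𝟙 _) (f g : End N) (H : endTensor h 1 f = endTensor h 1 g) : f = g := by
  rw [endTensor_eq, endTensor_eq, End.one_def, id_tensorHom, id_tensorHom] at H
  replace H := (cancel_mono _).mp ((cancel_epi _).mp H)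
  -- The retract lemma is applied with `X = 𝟙_ C` and `Y = N`.
  exact whiskerLeft_injective_of_retract (η := η ≫ (λ_ N).inv) (ε := (λ_ N).hom ≫ ε)
    (by simpa using hε) H

theorem endTensor_one_right_injective (h : N ⊗ N = N) {η : 𝟙_ C ⟶ N} {ε : N ⟶ 𝟙_ C}
    (hε : η ≫ ε = 𝟙 _) (f g : End N) (H : endTensor h f 1 = endTensor h g 1) : f = g := by
  rw [endTensor_eq, endTensor_eq, End.one_def, tensorHom_id, tensorHom_id] at H
  replace H := (cancel_mono _).mp ((cancel_epi _).mp H)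
  exact whiskerRight_injective_of_retract (η := η ≫ (ρ_ N).inv) (ε := (ρ_ N).hom ≫ ε)
    (by simpa using hε) H

variable [SymmetricCategory C] [CompactClosedCategory C] {X : C}

theorem isAHFrobenius_endSplit_endMerge (h : N ⊗ N = N) (φ : dualObj X ⊗ X ≅ N) :
    IsAHFrobenius (endTensor h) (endAssoc h) (endAssocInv h) (endSplit h φ) (endMerge h φ) :=
  isAHFrobenius_of_iso h φ (innerSplit_innerMerge_left (cup X) (cap X))
    (innerSplit_innerMerge_right (cup X) (cap X)) (innerMerge_assoc (cap X))
    (innerSplit_coassoc (cup X))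

theorem endMerge_mul_endSplit (hI : Subsingleton (𝟙_ C ⟶ 𝟙_ C)) (h : N ⊗ N = N)
    (φ : dualObj X ⊗ X ≅ N) : endMerge h φ * endSplit h φ = 1 := by
  have e : canonicalSplit X ≫ canonicalMerge X = 𝟙 _ :=
    innerSplit_innerMerge (cup X) (cap X) (Subsingleton.elim _ _)
  simp [endMerge, endSplit, End.mul_def, End.one_def, reassoc_of% e]

theorem endSplit_mul_endMerge_ne_one (hI : Subsingleton (𝟙_ C ⟶ 𝟙_ C)) (h : N ⊗ N = N)
    (hunit : IsEmpty (N ≅ 𝟙_ C)) (φ : dualObj X ⊗ X ≅ N) :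
    endSplit h φ * endMerge h φ ≠ 1 := by
  intro H
  have hs : cup X ≫ cap X = 𝟙 _ := Subsingleton.elim _ _
  have e : canonicalMerge X ≫ canonicalSplit X = 𝟙 _ := by
    simp only [endMerge, endSplit, End.mul_def, End.one_def] at H
    have := congrArg (fun f => (φ.hom ⊗ₘ φ.hom) ≫ eqToHom h ≫ f ≫ eqToHom h.symm ≫
      (φ.inv ⊗ₘ φ.inv)) H
    simpa using this
  -- The chain is `N ≅ X* ⊗ X ≅ X ⊗ X* ≅ I`, the last step by `cap X` and `cup X`.
  exact hunit.false (φ.symm ≪≫ β_ _ _ ≪≫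
    ⟨cap X, cup X, comp_eq_id_of_innerMerge_innerSplit hs e, hs⟩)

end Main

theorem mainTheorem3 {C : Type u} [Category.{v} C] [MonoidalCategory C] [SymmetricCategory C]
    [CompactClosedCategory C]
    -- trivial scalars
    (hI : Subsingleton (𝟙_ C ⟶ 𝟙_ C))
    -- a strictly reflexive object that is not a unit object
    (N : C) (hN : CompactClosedCategory.IsStrictlyReflexive N) (hunit : IsEmpty (N ≅ 𝟙_ C))
    -- any presentation of `N` as `X* ⊗ X`; one of them is `X = N` with the identity arrow
    (X : C) (φ : CompactClosedCategory.dualObj X ⊗ X ≅ N) :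
    -- `C(N,N)` is a semi-monoidal monoid, with an Abramsky-Heunen Frobenius algebra
    IsSemiMonoidalMonoid (endTensor hN.tensor_eq) (endAssoc hN.tensor_eq)
      (endAssocInv hN.tensor_eq) ∧
    IsAHFrobenius (endTensor hN.tensor_eq) (endAssoc hN.tensor_eq) (endAssocInv hN.tensor_eq)
      (endSplit hN.tensor_eq φ) (endMerge hN.tensor_eq φ) ∧
    -- the simple A-H F monoid is generated, under composition and tensor, by `α, α⁻¹, Δ, ∇`
    (standardAHFMonoid hN.tensor_eq φ : Set (End N)) =
      {f | CompTensorClosure (endTensor hN.tensor_eq)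
        {endAssoc hN.tensor_eq, endAssocInv hN.tensor_eq,
          endSplit hN.tensor_eq φ, endMerge hN.tensor_eq φ} f} ∧
    -- within it, `α, α⁻¹` generate, under composition and tensor, a copy of Thompson's group
    {f | CompTensorClosure (endTensor hN.tensor_eq)
        {endAssoc hN.tensor_eq, endAssocInv hN.tensor_eq} f} ⊆
      (standardAHFMonoid hN.tensor_eq φ : Set (End N)) ∧
    (∃ F : ThompsonF →* End N, Function.Injective F ∧
      Set.range F = {f | CompTensorClosure (endTensor hN.tensor_eq)
        {endAssoc hN.tensor_eq, endAssocInv hN.tensor_eq} f}) ∧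
    -- within it, `Δ, ∇` generate, under composition, a copy of the bicyclic monoid
    endMerge hN.tensor_eq φ * endSplit hN.tensor_eq φ = 1 ∧
    endSplit hN.tensor_eq φ * endMerge hN.tensor_eq φ ≠ 1 ∧
    Submonoid.closure {endSplit hN.tensor_eq φ, endMerge hN.tensor_eq φ} ≤
      standardAHFMonoid hN.tensor_eq φ ∧
    (∃ B : BicyclicMonoid →* End N, Function.Injective B ∧
      B (PresentedMonoid.of BicyclicRel BicyclicGen.s) = endSplit hN.tensor_eq φ ∧
      B (PresentedMonoid.of BicyclicRel BicyclicGen.r) = endMerge hN.tensor_eq φ ∧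
      MonoidHom.mrange B =
        Submonoid.closure {endSplit hN.tensor_eq φ, endMerge hN.tensor_eq φ}) := by
  have hM := isSemiMonoidalMonoid_endTensor hN.tensor_eq
  have hmd := endMerge_mul_endSplit hI hN.tensor_eq φ
  have hdm := endSplit_mul_endMerge_ne_one hI hN.tensor_eq hunit φ
  have hA := ahfMonoid_eq_compTensorClosure (d := endSplit hN.tensor_eq φ)
    (m := endMerge hN.tensor_eq φ) hM
  -- The composite `I ⟶ N ⟶ I` is a scalar, hence the identity.
  have hr := endTensor_one_left_injective hN.tensor_eq
    (η := CompactClosedCategory.cup X ≫ (β_ _ _).hom ≫ φ.hom)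
    (ε := φ.inv ≫ (β_ _ _).hom ≫ CompactClosedCategory.cap X) (Subsingleton.elim _ _)
  have hl := endTensor_one_right_injective hN.tensor_eq
    (η := CompactClosedCategory.cup X ≫ (β_ _ _).hom ≫ φ.hom)
    (ε := φ.inv ≫ (β_ _ _).hom ≫ CompactClosedCategory.cap X) (Subsingleton.elim _ _)
  have hc : ¬ ∀ f g : End N, f * g = g * f := fun H => hdm ((H _ _).trans hmd)
  refine ⟨hM, isAHFrobenius_endSplit_endMerge hN.tensor_eq φ, hA, ?_,
    ⟨thompsonHom hM, thompsonHom_injective hM hr hl hc, range_thompsonHom hM⟩, hmd, hdm, ?_,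
    ⟨bicyclicHom hmd, bicyclicHom_injective hmd hdm, bicyclicHom_s hmd, bicyclicHom_r hmd,
      mrange_bicyclicHom hmd⟩⟩
  · rw [standardAHFMonoid, hA]
    exact fun f hf => CompTensorClosure.mono (by rintro x (rfl | rfl) <;> simp) hf
  · rw [Submonoid.closure_le, standardAHFMonoid, hA]
    rintro x (rfl | rfl) <;> exact .of _ (by simp)
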